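/- Let $n\ge 1$, let $c>0$, and let $\mathbb M^n=\mathbb R^n$ be $n$-dimensional Minkowski space with scalar product $g(x,y)=x^0y^0-\sum_{i=1}^{n-1}x^iy^i$. Let $\Omega\subseteq\mathbb M^n$ be open and connected and let $u:\Omega\to\mathbb R^n$ be a smooth normalized timelike vector field, i.e. $g(u,u)=c^2$ on $\Omega$. Put $u^\flat=g(u,\cdot)$, let $h=c^{-2}\,u^\flat\otimes u^\flat-g$ be the spatial metric, let $P_h=\mathrm{id}-c^{-2}\,u\otimes u^\flat$ be the projector onto the orthogonal complement of $u$, and let $\omega$ be the vorticity of $u$, $$\omega(v,w)=\tfrac12\,(du^\flat)(P_hv,P_hw),\qquad (du^\flat)(v,w)=g(\partial_vu,w)-g(\partial_wu,v).$$ **Theorem (Noether and Herglotz, part 1).** Suppose that the motion described by the flow of $u$ is rigid, i.e. $L_uh=0$ on $\Omega$, where $L_u$ is the Lie derivative along $u$, and rotational, i.e. $\omega$ does not vanish identically on $\Omega$. Then it is a Killing motion: there is a smooth vector field $K$ on $\Omega$ with $L_Kg=0$ and $g(K,K)>0$ on $\Omega$ such that $u=c\,K/\sqrt{g(K,K)}$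 on $\Omega$. -/

import Mathlib

open scoped ContDiff

/-- The vector space `ℝ ^ (1 + d)` of inertial coordinates `(x⁰, x¹, …, xᵈ)` with `x⁰ = ct`,
modelling Minkowski space of dimension `n = d + 1`. -/
abbrev Minkowski (d : ℕ) : Type := Fin (d + 1) → ℝ

namespace Minkowski

noncomputable section

variable {d : ℕ}

/-- The Minkowski scalar product, of signature `(+, -, …, -)`:
`g (x, y) = x⁰ y⁰ - ∑ i, xⁱ yⁱ`. -/
def g (d : ℕ) : LinearMap.BilinForm ℝ (Minkowski d) :=
  LinearMap.mk₂ ℝ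
    (fun x y => x 0 * y 0 - ∑ i : Fin d, x i.succ * y i.succ)
    (by intro x x' y; simp only [Pi.add_apply, add_mul, Finset.sum_add_distrib]; ring)
    (by
      intro r x y
      simp only [Pi.smul_apply, smul_eq_mul, mul_sub, Finset.mul_sum, mul_assoc])
    (by intro x y y'; simp only [Pi.add_apply, mul_add, Finset.sum_add_distrib]; ring)
    (by
      intro r x y
      simp only [Pi.smul_apply, smul_eq_mul, mul_sub, Finset.mul_sum, mul_left_comm])

/-- The Lie derivative `L_X T` of a field `T` of covariant 2-tensors along the vector field `X`:
`(L_X T)(v, w) = ∂_X (T (v, w)) + T (∂_v X, w) + T (v, ∂_w X)` for constant `v`, `w`. -/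
def lieDeriv (X : Minkowski d → Minkowski d) (T : Minkowski d → LinearMap.BilinForm ℝ (Minkowski d))
    (p v w : Minkowski d) : ℝ :=
  fderiv ℝ (fun q => T q v w) p (X p) + T p (fderiv ℝ X p v) w + T p v (fderiv ℝ X p w)

/-- A smooth vector field `u` on `Ω`, timelike and normalized: `g (u, u) = c²`. -/
structure IsVelocityField (c : ℝ) (Ω : Set (Minkowski d)) (u : Minkowski d → Minkowski d) :
    Prop where
  smooth : ContDiffOn ℝ ∞ u Ω
  normalized : ∀ p ∈ Ω, g d (u p) (u p) = c ^ 2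

/-- The spatial metric `h = c⁻² u♭ ⊗ u♭ - g`, where `u♭ = g (u, ·)`. -/
def spatialMetric (c : ℝ) (u : Minkowski d → Minkowski d) (p : Minkowski d) :
    LinearMap.BilinForm ℝ (Minkowski d) :=
  (c ^ 2)⁻¹ • LinearMap.BilinForm.linMulLin (g d (u p)) (g d (u p)) - g d

/-- The motion described by the flow of `u` is (Born) rigid on `Ω`: `L_u h = 0`. -/
def IsRigid (c : ℝ) (Ω : Set (Minkowski d)) (u : Minkowski d → Minkowski d) : Prop :=
  ∀ p ∈ Ω, ∀ v w : Minkowski d, lieDeriv u (spatialMetric c u) p v w = 0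

/-- The projector `P_h = id - c⁻² u ⊗ u♭` onto the orthogonal complement of `u`. -/
def proj (c : ℝ) (u : Minkowski d → Minkowski d) (p : Minkowski d) :
    Minkowski d →ₗ[ℝ] Minkowski d :=
  LinearMap.id - (c ^ 2)⁻¹ • (g d (u p)).smulRight (u p)

/-- The derivative `∇u♭` of the velocity one-form: `(∇u♭)(v, w) = g (∂_v u, w)`. -/
def nablaFlat (u : Minkowski d → Minkowski d) (p : Minkowski d) :
    LinearMap.BilinForm ℝ (Minkowski d) :=
  (g d).comp (fderiv ℝ u p).toLinearMap LinearMap.id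

/-- The vorticity `ω = ½ P_h (∇ ∧ u♭)`, where
`(∇ ∧ u♭)(v, w) = (∇u♭)(v, w) - (∇u♭)(w, v)`. -/
def vorticity (c : ℝ) (u : Minkowski d → Minkowski d) (p : Minkowski d) :
    LinearMap.BilinForm ℝ (Minkowski d) :=
  (1 / 2 : ℝ) • (nablaFlat u p - (nablaFlat u p).flip).comp (proj c u p) (proj c u p)

/-- The motion is rotational on `Ω`: its vorticity does not vanish identically. -/
def IsRotational (c : ℝ) (Ω : Set (Minkowski d)) (u : Minkowski d → Minkowski d) : Prop :=
  ∃ p ∈ Ω, vorticity c u p ≠ 0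

/-- `K` is a smooth Killing field on `Ω`: `L_K g = 0`. -/
structure IsKillingField (Ω : Set (Minkowski d)) (K : Minkowski d → Minkowski d) : Prop where
  smooth : ContDiffOn ℝ ∞ K Ω
  killing : ∀ p ∈ Ω, ∀ v w : Minkowski d, lieDeriv K (fun _ => g d) p v w = 0

/-- The flow of `u` is a Killing motion on `Ω`: there is a timelike Killing field `K` on `Ω`
with `u = c K / √(K²)`. -/
def IsKillingMotion (c : ℝ) (Ω : Set (Minkowski d)) (u : Minkowski d → Minkowski d) : Prop :=
  ∃ K : Minkowski d → Minkowski d, IsKillingField Ω K ∧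
    ∀ p ∈ Ω, 0 < g d (K p) (K p) ∧ u p = (c / √(g d (K p) (K p))) • K p

end

end Minkowski

/-! Normalize to `c = 1` and let `a = ∂_u u`. Rigidity says that the strain, the symmetrized
derivative of `u♭`, is `u♭ ⊗ a♭ + a♭ ⊗ u♭`. A field `K = λ u` with this strain is Killing exactly
when `dλ = -λ a♭`, so the main point is that `a♭` is closed.

Any strain, being a symmetrized derivative, satisfies second-order compatibility conditions, because
third derivatives of `u♭` commute. Evaluated on vectors orthogonal to `u`, they give `ω(v, w) da♭(v,
w) = 0` (`vorticity_mul_curl_acc`). If a product of two bilinear forms vanishes identically, one of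
them is zero, so at rotational points `da♭` vanishes on the complement of `u`. Rotational points
form an open set; there `da♭ = u♭ ∧ β` with `β = da♭(u, ·)`, and this may be differentiated. A mixed
compatibility condition then gives `ω(v, w) β(w) = 0` (`vorticity_mul_curl_acc_vel`), hence `β = 0`
and `da♭ = 0` (`curl_acc_eq_zero`).

With `da♭ = 0` the would-be Killing data of `u`, a linear part and a constant part, satisfy `∂_x σ =
a♭(x) σ` (`fderiv_killingData`), so `σ` stays locally on a ray. Proportional data preserve
rotationality (`isRotationalAt_of_killingData_eq`), so the points that are rotational and have data
on the positive ray of a base point form an open and relatively closed subset of `Ω`, that is, all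
of `Ω`. The affine field with the data of the base point is `K`. Since one ray serves everywhere, no
potential of `a♭` has to be chosen and simple connectedness is not needed. -/

section DirDeriv

/-! ### Calculus of derivatives in constant directions. -/

variable {E F : Type*} [NormedAddCommGroup E] [NormedSpace ℝ E]
  [NormedAddCommGroup F] [NormedSpace ℝ F] {Ω : Set E}

/-- The derivative of `f` in the direction of the constant vector `v`, as a function of the
point. -/
noncomputable def dirDeriv (v : E) (f : E → F) (q : E) : F := fderiv ℝ f q v

theorem ContDiffOn.dirDeriv {f : E → F} (hΩ : IsOpen Ω) (hf : ContDiffOn ℝ ∞ f Ω) (v : E) :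
    ContDiffOn ℝ ∞ (dirDeriv v f) Ω :=
  (hf.fderiv_of_isOpen hΩ (by simp)).clm_apply contDiffOn_const

theorem ContDiffOn.differentiableAt_of_isOpen {f : E → F} (hΩ : IsOpen Ω)
    (hf : ContDiffOn ℝ ∞ f Ω) {q : E} (hq : q ∈ Ω) : DifferentiableAt ℝ f q :=
  (hf.contDiffAt (hΩ.mem_nhds hq)).differentiableAt (by simp)

theorem dirDeriv_congr {f g : E → F} (hΩ : IsOpen Ω) (h : Set.EqOn f g Ω) (v : E) :
    Set.EqOn (dirDeriv v f) (dirDeriv v g) Ω := fun q hq => by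
  have : f =ᶠ[nhds q] g := Filter.eventuallyEq_of_mem (hΩ.mem_nhds hq) h
  simp only [dirDeriv, this.fderiv_eq]

theorem dirDeriv_add {f g : E → F} (hΩ : IsOpen Ω) (hf : ContDiffOn ℝ ∞ f Ω)
    (hg : ContDiffOn ℝ ∞ g Ω) (v : E)
    {q : E} (hq : q ∈ Ω) : dirDeriv v (fun q => f q + g q) q = dirDeriv v f q + dirDeriv v g q := by
  simp only [dirDeriv, fderiv_fun_add (hf.differentiableAt_of_isOpen hΩ hq)
    (hg.differentiableAt_of_isOpen hΩ hq), add_apply]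

theorem dirDeriv_mul {f g : E → ℝ} (hΩ : IsOpen Ω) (hf : ContDiffOn ℝ ∞ f Ω)
    (hg : ContDiffOn ℝ ∞ g Ω) (v : E)
    {q : E} (hq : q ∈ Ω) :
    dirDeriv v (fun q => f q * g q) q = f q * dirDeriv v g q + dirDeriv v f q * g q := by
  simp only [dirDeriv, fderiv_fun_mul (hf.differentiableAt_of_isOpen hΩ hq)
    (hg.differentiableAt_of_isOpen hΩ hq), add_apply, smul_apply, smul_eq_mul]
  ring

theorem dirDeriv_comm {f : E → F} (hΩ : IsOpen Ω) (hf : ContDiffOn ℝ ∞ f Ω) (v w : E) :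
    Set.EqOn (dirDeriv v (dirDeriv w f)) (dirDeriv w (dirDeriv v f)) Ω := fun q hq => by
  have hd : DifferentiableAt ℝ (fderiv ℝ f) q :=
    (hf.fderiv_of_isOpen hΩ (m := ∞) (by simp)).differentiableAt_of_isOpen hΩ hq
  have key : ∀ x y : E, dirDeriv x (dirDeriv y f) q = fderiv ℝ (fderiv ℝ f) q x y := by
    intro x y
    change fderiv ℝ (fun q => fderiv ℝ f q y) q x = _
    rw [fderiv_clm_apply hd (differentiableAt_const y)]
    simp
  rw [key, key]
  exact (hf.contDiffAt (hΩ.mem_nhds hq)).isSymmSndFDerivAt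
    (by rw [minSmoothness_of_isRCLikeNormedField]; exact WithTop.coe_le_coe.2 le_top) v w

theorem dirDeriv_comm₂ {f : E → F} (hΩ : IsOpen Ω) (hf : ContDiffOn ℝ ∞ f Ω) (x v w : E) :
    Set.EqOn (dirDeriv x (dirDeriv v (dirDeriv w f))) (dirDeriv x (dirDeriv w (dirDeriv v f))) Ω :=
  dirDeriv_congr hΩ (dirDeriv_comm hΩ hf v w) x

end DirDeriv

/-! ### The scalar product, lowered fields and the strain of a unit rigid field. -/

namespace Minkowski

variable {d : ℕ} {Ω : Set (Minkowski d)} {u : Minkowski d → Minkowski d}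

theorem g_apply (x y : Minkowski d) : g d x y = x 0 * y 0 - ∑ i : Fin d, x i.succ * y i.succ := rfl

theorem g_comm (x y : Minkowski d) : g d x y = g d y x := by
  simp only [g_apply, mul_comm]

theorem eq_zero_of_g {x : Minkowski d} (h : ∀ y, g d x y = 0) : x = 0 := by
  funext i
  have := h (Pi.single i 1)
  refine Fin.cases (fun h => ?_) (fun j h => ?_) i this
  · simpa [g_apply] using h
  · simpa [g_apply, Pi.single_apply, Fin.succ_ne_zero, Fin.succ_inj, (Fin.succ_ne_zero j).symm]
      using h

theorem eq_of_g {x y : Minkowski d} (h : ∀ z, g d x z = g d y z) : x = y :=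
  sub_eq_zero.1 (eq_zero_of_g fun z => by rw [map_sub, LinearMap.sub_apply, h, sub_self])

/-- The Minkowski scalar product as a continuous bilinear map. -/
noncomputable def gL (d : ℕ) : Minkowski d →L[ℝ] Minkowski d →L[ℝ] ℝ :=
  (g d).toContinuousBilinearMap

theorem gL_apply (x y : Minkowski d) : gL d x y = g d x y := rfl

/-- The function `q ↦ g (X q, v)`, for a constant vector `v`. -/
noncomputable def flat (X : Minkowski d → Minkowski d) (v : Minkowski d) (q : Minkowski d) : ℝ :=
  g d (X q) v

/-- The acceleration `a = ∂_u u`. -/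
noncomputable def acc (u : Minkowski d → Minkowski d) (q : Minkowski d) : Minkowski d :=
  fderiv ℝ u q (u q)

theorem contDiffOn_flat {X : Minkowski d → Minkowski d} (hX : ContDiffOn ℝ ∞ X Ω)
    (v : Minkowski d) : ContDiffOn ℝ ∞ (flat X v) Ω :=
  ContDiffOn.clm_apply (((gL d).contDiff).comp_contDiffOn hX) contDiffOn_const

theorem contDiffOn_acc (hΩ : IsOpen Ω) (hu : ContDiffOn ℝ ∞ u Ω) : ContDiffOn ℝ ∞ (acc u) Ω :=
  (hu.fderiv_of_isOpen hΩ (by simp)).clm_apply hu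

theorem fderiv_g {X Y : Minkowski d → Minkowski d} {q : Minkowski d} (hX : DifferentiableAt ℝ X q)
    (hY : DifferentiableAt ℝ Y q) (v : Minkowski d) :
    fderiv ℝ (fun q => g d (X q) (Y q)) q v =
      g d (X q) (fderiv ℝ Y q v) + g d (fderiv ℝ X q v) (Y q) := by
  change fderiv ℝ (fun q => gL d (X q) (Y q)) q v = _
  have hX' : HasFDerivAt (fun q => gL d (X q)) ((gL d).comp (fderiv ℝ X q)) q :=
    (gL d).hasFDerivAt.comp q hX.hasFDerivAt
  rw [(hX'.clm_apply hY.hasFDerivAt).fderiv]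
  simp [gL_apply]

theorem dirDeriv_flat {X : Minkowski d → Minkowski d} {q : Minkowski d}
    (hX : DifferentiableAt ℝ X q) (v w : Minkowski d) :
    dirDeriv v (flat X w) q = g d (fderiv ℝ X q v) w := by
  change fderiv ℝ (fun q => g d (X q) w) q v = _
  rw [fderiv_g hX (differentiableAt_const w)]
  simp

/-- A smooth vector field with `g (u, u) = 1` whose strain is
`g (∂_v u, w) + g (∂_w u, v) = g (u, v) g (a, w) + g (a, v) g (u, w)`: the rigidity condition in
units where `c = 1`. -/
structure IsUnitRigid (Ω : Set (Minkowski d)) (u : Minkowski d → Minkowski d) : Prop where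
  isOpen : IsOpen Ω
  smooth : ContDiffOn ℝ ∞ u Ω
  unit : ∀ q ∈ Ω, g d (u q) (u q) = 1
  strain : ∀ q ∈ Ω, ∀ v w : Minkowski d, g d (fderiv ℝ u q v) w + g d (fderiv ℝ u q w) v =
    g d (u q) v * g d (acc u q) w + g d (acc u q) v * g d (u q) w

namespace IsUnitRigid

variable (H : IsUnitRigid Ω u)

include H

theorem dirDeriv_flat_add (v w : Minkowski d) :
    Set.EqOn (fun q => dirDeriv v (flat u w) q + dirDeriv w (flat u v) q)
      (fun q => flat u v q * flat (acc u) w q + flat (acc u) v q * flat u w q) Ω := fun q hq => by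
  have hd := H.smooth.differentiableAt_of_isOpen H.isOpen hq
  simp only [dirDeriv_flat hd]
  exact H.strain q hq v w

end IsUnitRigid
end Minkowski

/-! ### Derivatives of the strain and the first compatibility condition. -/

namespace Minkowski

variable {d : ℕ} {Ω : Set (Minkowski d)} {u : Minkowski d → Minkowski d}

namespace IsUnitRigid

variable (H : IsUnitRigid Ω u)

include H

theorem contDiffOn_flat_vel (v : Minkowski d) : ContDiffOn ℝ ∞ (flat u v) Ω :=
  contDiffOn_flat H.smooth v

theorem contDiffOn_flat_acc (v : Minkowski d) : ContDiffOn ℝ ∞ (flat (acc u) v) Ω :=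
  contDiffOn_flat (contDiffOn_acc H.isOpen H.smooth) v

theorem dirDeriv_strain (x v w : Minkowski d) :
    Set.EqOn (fun q => dirDeriv x (dirDeriv v (flat u w)) q + dirDeriv x (dirDeriv w (flat u v)) q)
      (fun q => flat u v q * dirDeriv x (flat (acc u) w) q
        + dirDeriv x (flat u v) q * flat (acc u) w q
        + (flat (acc u) v q * dirDeriv x (flat u w) q
        + dirDeriv x (flat (acc u) v) q * flat u w q)) Ω := fun q hq => by
  have hU := H.contDiffOn_flat_vel
  have hA := H.contDiffOn_flat_acc
  have h := dirDeriv_congr H.isOpen (H.dirDeriv_flat_add v w) x hq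
  beta_reduce
  rwa [dirDeriv_add H.isOpen ((hU w).dirDeriv H.isOpen v) ((hU v).dirDeriv H.isOpen w) x hq,
    dirDeriv_add H.isOpen ((hU v).mul (hA w)) ((hA v).mul (hU w)) x hq,
    dirDeriv_mul H.isOpen (hU v) (hA w) x hq, dirDeriv_mul H.isOpen (hA v) (hU w) x hq] at h

theorem dirDeriv_dirDeriv_strain (y x v w : Minkowski d) {q : Minkowski d} (hq : q ∈ Ω) :
    dirDeriv y (dirDeriv x (dirDeriv v (flat u w))) q
      + dirDeriv y (dirDeriv x (dirDeriv w (flat u v))) q =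
      flat u v q * dirDeriv y (dirDeriv x (flat (acc u) w)) q
        + dirDeriv y (flat u v) q * dirDeriv x (flat (acc u) w) q
        + (dirDeriv x (flat u v) q * dirDeriv y (flat (acc u) w) q
          + dirDeriv y (dirDeriv x (flat u v)) q * flat (acc u) w q)
        + (flat (acc u) v q * dirDeriv y (dirDeriv x (flat u w)) q
          + dirDeriv y (flat (acc u) v) q * dirDeriv x (flat u w) q
          + (dirDeriv x (flat (acc u) v) q * dirDeriv y (flat u w) q
            + dirDeriv y (dirDeriv x (flat (acc u) v)) q * flat u w q)) := by
  have ho := H.isOpen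
  have hU := H.contDiffOn_flat_vel
  have hA := H.contDiffOn_flat_acc
  have hU' := fun v => (hU v).dirDeriv ho x
  have hA' := fun v => (hA v).dirDeriv ho x
  have h := dirDeriv_congr ho (H.dirDeriv_strain x v w) y hq
  rwa [dirDeriv_add ho (((hU w).dirDeriv ho v).dirDeriv ho x)
      (((hU v).dirDeriv ho w).dirDeriv ho x) y hq,
    dirDeriv_add ho (((hU v).mul (hA' w)).add ((hU' v).mul (hA w)))
      (((hA v).mul (hU' w)).add ((hA' v).mul (hU w))) y hq,
    dirDeriv_add ho ((hU v).mul (hA' w)) ((hU' v).mul (hA w)) y hq,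
    dirDeriv_add ho ((hA v).mul (hU' w)) ((hA' v).mul (hU w)) y hq,
    dirDeriv_mul ho (hU v) (hA' w) y hq, dirDeriv_mul ho (hU' v) (hA w) y hq,
    dirDeriv_mul ho (hA v) (hU' w) y hq, dirDeriv_mul ho (hA' v) (hU w) y hq] at h

/-- On vectors orthogonal to `u`, the product of the vorticity and of `da` vanishes: this is the
invariance along `u` of the square of the vorticity, which follows from the compatibility
condition for the strain. -/
theorem vorticity_mul_curl_acc {q : Minkowski d} (hq : q ∈ Ω) {v w : Minkowski d}
    (hv : flat u v q = 0) (hw : flat u w q = 0) :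
    dirDeriv v (flat u w) q *
      (dirDeriv v (flat (acc u) w) q - dirDeriv w (flat (acc u) v) q) = 0 := by
  have ho := H.isOpen
  have hU := H.contDiffOn_flat_vel
  have hA := H.contDiffOn_flat_acc
  have s_vw := H.dirDeriv_flat_add v w hq
  have s_vv := H.dirDeriv_flat_add v v hq
  have s_ww := H.dirDeriv_flat_add w w hq
  have t_wvw := H.dirDeriv_strain w v w hq
  have t_vvw := H.dirDeriv_strain v v w hq
  have t_wvv := H.dirDeriv_strain w v v hq
  have t_vww := H.dirDeriv_strain v w w hq
  -- With `S` the strain, third derivatives cancel in `∂_v ∂_v S(w, w) + ∂_w ∂_w S(v, v) - 2 ∂_v ∂_w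
  -- S(v, w) = 0`; these are its three ingredients.
  have r_vw := H.dirDeriv_dirDeriv_strain v w v w hq
  have r_vv := H.dirDeriv_dirDeriv_strain w w v v hq
  have r_ww := H.dirDeriv_dirDeriv_strain v v w w hq
  have c_v := dirDeriv_comm ho (hU v) v w hq
  have c_w := dirDeriv_comm ho (hU w) v w hq
  have c_vvw := dirDeriv_comm₂ ho (hU w) v v w hq
  have c_vww := dirDeriv_comm ho ((hU v).dirDeriv ho w) v w hq
  have c_wwv := dirDeriv_comm₂ ho (hU v) w v w hq
  simp only [hv, hw, zero_mul, mul_zero, add_zero, zero_add] at *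
  have e_vv : dirDeriv v (flat u v) q = 0 := by linarith
  have e_ww : dirDeriv w (flat u w) q = 0 := by linarith
  have e_wv : dirDeriv w (flat u v) q = - dirDeriv v (flat u w) q := by linarith
  simp only [e_vv, e_ww, e_wv, zero_mul, mul_zero, add_zero, zero_add] at *
  -- The once differentiated strain, with commuting derivatives, expresses the second derivatives of
  -- `u♭` that remain through vorticity and acceleration.
  have f_vww : dirDeriv v (dirDeriv w (flat u w)) q
      = dirDeriv v (flat u w) q * flat (acc u) w q := by linarith
  have f_wwv : dirDeriv w (dirDeriv w (flat u v)) q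
      = - 2 * (dirDeriv v (flat u w) q * flat (acc u) w q) := by linarith
  have f_vwv : dirDeriv v (dirDeriv w (flat u v)) q
      = - (dirDeriv v (flat u w) q * flat (acc u) v q) := by linarith
  have f_vvw : dirDeriv v (dirDeriv v (flat u w)) q
      = 2 * (dirDeriv v (flat u w) q * flat (acc u) v q) := by linarith
  rw [f_vww, f_vwv] at r_vw
  rw [f_wwv] at r_vv
  rw [f_vvw] at r_ww
  linarith

end IsUnitRigid
end Minkowski

/-! ### The exterior derivative of the acceleration form and the second compatibility condition. -/

namespace Minkowski

variable {d : ℕ} {Ω : Set (Minkowski d)} {u : Minkowski d → Minkowski d}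

/-- The exterior derivative `(dX♭)(v, w) = g (∂_v X, w) - g (∂_w X, v)`. -/
noncomputable def curl (X : Minkowski d → Minkowski d) (q v w : Minkowski d) : ℝ :=
  g d (fderiv ℝ X q v) w - g d (fderiv ℝ X q w) v

theorem curl_self (X : Minkowski d → Minkowski d) (q v : Minkowski d) : curl X q v v = 0 :=
  sub_self _

theorem curl_swap (X : Minkowski d → Minkowski d) (q v w : Minkowski d) :
    curl X q v w = - curl X q w v := (neg_sub _ _).symm

theorem curl_add_smul_left (X : Minkowski d → Minkowski d) (q v v' w : Minkowski d) (r : ℝ) :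
    curl X q (v + r • v') w = curl X q v w + r * curl X q v' w := by
  simp only [curl, map_add, map_smul, LinearMap.add_apply, LinearMap.smul_apply, smul_eq_mul]
  ring

theorem curl_add_smul_right (X : Minkowski d → Minkowski d) (q v w w' : Minkowski d) (r : ℝ) :
    curl X q v (w + r • w') = curl X q v w + r * curl X q v w' := by
  rw [curl_swap, curl_add_smul_left, curl_swap X q w, curl_swap X q w']
  ring

namespace IsUnitRigid

theorem mono (H : IsUnitRigid Ω u) {S : Set (Minkowski d)} (hS : IsOpen S) (hSΩ : S ⊆ Ω) :
    IsUnitRigid S u :=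
  ⟨hS, H.smooth.mono hSΩ, fun q hq => H.unit q (hSΩ hq), fun q hq => H.strain q (hSΩ hq)⟩

variable (H : IsUnitRigid Ω u)

include H

theorem differentiableAt {q : Minkowski d} (hq : q ∈ Ω) : DifferentiableAt ℝ u q :=
  H.smooth.differentiableAt_of_isOpen H.isOpen hq

theorem differentiableAt_acc {q : Minkowski d} (hq : q ∈ Ω) : DifferentiableAt ℝ (acc u) q :=
  (contDiffOn_acc H.isOpen H.smooth).differentiableAt_of_isOpen H.isOpen hq

theorem curl_acc {q : Minkowski d} (hq : q ∈ Ω) (v w : Minkowski d) :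
    curl (acc u) q v w = dirDeriv v (flat (acc u) w) q - dirDeriv w (flat (acc u) v) q := by
  rw [dirDeriv_flat (H.differentiableAt_acc hq), dirDeriv_flat (H.differentiableAt_acc hq), curl]

theorem g_fderiv_vel {q : Minkowski d} (hq : q ∈ Ω) (v : Minkowski d) :
    g d (fderiv ℝ u q v) (u q) = 0 := by
  have hd := H.differentiableAt hq
  have h1 : (fun q => g d (u q) (u q)) =ᶠ[nhds q] fun _ => 1 :=
    Filter.eventuallyEq_of_mem (H.isOpen.mem_nhds hq) H.unit
  have h2 := fderiv_g hd hd v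
  rw [h1.fderiv_eq, g_comm (u q)] at h2
  simp only [fderiv_fun_const, Pi.zero_apply, zero_apply] at h2
  linarith

theorem g_acc_vel {q : Minkowski d} (hq : q ∈ Ω) : g d (acc u q) (u q) = 0 :=
  H.g_fderiv_vel hq _

/-- The component of `v` orthogonal to `u`. -/
theorem g_vel_sub {q : Minkowski d} (hq : q ∈ Ω) (v : Minkowski d) :
    g d (u q) (v - g d (u q) v • u q) = 0 := by
  rw [map_sub, map_smul, H.unit q hq, smul_eq_mul, mul_one, sub_self]

/-- Split `v` and `w` into components along and orthogonal to `u`: only the mixed terms survive, so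
`da♭ = u♭ ∧ β` with `β = da♭(u, ·)`. -/
theorem curl_acc_eq {q : Minkowski d} (hq : q ∈ Ω)
    (hc : ∀ v w, flat u v q = 0 → flat u w q = 0 → curl (acc u) q v w = 0) (v w : Minkowski d) :
    curl (acc u) q v w =
      flat u v q * curl (acc u) q (u q) w - flat u w q * curl (acc u) q (u q) v := by
  have h := hc _ _ (H.g_vel_sub hq v) (H.g_vel_sub hq w)
  rw [sub_eq_add_neg, sub_eq_add_neg, ← neg_smul, ← neg_smul, curl_add_smul_left,
    curl_add_smul_right, curl_add_smul_right, curl_self, curl_swap _ _ v (u q)] at h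
  simp only [flat]
  linarith

/-- Differentiate `da♭ = u♭ ∧ β`. The derivatives of `β` drop out because their factors `u♭(v)` and
`u♭(w)` vanish at `q`. -/
theorem dirDeriv_curl_acc
    (hc : ∀ q ∈ Ω, ∀ v w, flat u v q = 0 → flat u w q = 0 → curl (acc u) q v w = 0)
    {q : Minkowski d} (hq : q ∈ Ω) {v w : Minkowski d} (hv : flat u v q = 0) (hw : flat u w q = 0)
    (x : Minkowski d) :
    dirDeriv x (dirDeriv v (flat (acc u) w)) q - dirDeriv x (dirDeriv w (flat (acc u) v)) q =
      dirDeriv x (flat u v) q * curl (acc u) q (u q) w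
        - dirDeriv x (flat u w) q * curl (acc u) q (u q) v := by
  have ho := H.isOpen
  have hU := H.contDiffOn_flat_vel
  have hA := H.contDiffOn_flat_acc
  have ha := contDiffOn_acc ho H.smooth
  have hB : ∀ w, ContDiffOn ℝ ∞ (fun q => curl (acc u) q (u q) w) Ω := fun w =>
    (ContDiffOn.clm_apply ((gL d).contDiff.comp_contDiffOn
      ((ha.fderiv_of_isOpen ho (by simp)).clm_apply H.smooth)) contDiffOn_const).sub
    (ContDiffOn.clm_apply ((gL d).contDiff.comp_contDiffOn
      ((ha.fderiv_of_isOpen ho (by simp)).clm_apply contDiffOn_const)) H.smooth)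
  have h : Set.EqOn (fun q => dirDeriv v (flat (acc u) w) q
        + flat u w q * curl (acc u) q (u q) v)
      (fun q => dirDeriv w (flat (acc u) v) q + flat u v q * curl (acc u) q (u q) w) Ω := by
    intro p hp
    have := H.curl_acc_eq hp (hc p hp) v w
    rw [H.curl_acc hp] at this
    beta_reduce
    linarith
  have h' := dirDeriv_congr ho h x hq
  rw [dirDeriv_add ho ((hA w).dirDeriv ho v) ((hU w).mul (hB v)) x hq,
    dirDeriv_add ho ((hA v).dirDeriv ho w) ((hU v).mul (hB w)) x hq,
    dirDeriv_mul ho (hU w) (hB v) x hq, dirDeriv_mul ho (hU v) (hB w) x hq, hv, hw] at h'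
  linarith

/-- This is the compatibility condition `∂_X ∂_v S(w, w) + ∂_w ∂_w S(v, X) = ∂_X ∂_w S(v, w) + ∂_w
∂_v S(X, w)` for the strain `S`, with `X` the value of `u` at `q`. -/
theorem vorticity_mul_curl_acc_vel
    (hc : ∀ q ∈ Ω, ∀ v w, flat u v q = 0 → flat u w q = 0 → curl (acc u) q v w = 0)
    {q : Minkowski d} (hq : q ∈ Ω) {v w : Minkowski d} (hv : flat u v q = 0)
    (hw : flat u w q = 0) :
    dirDeriv v (flat u w) q * curl (acc u) q (u q) w = 0 := by
  have ho := H.isOpen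
  have hU := H.contDiffOn_flat_vel
  have hA := H.contDiffOn_flat_acc
  have hd := H.differentiableAt hq
  have hcvw := hc q hq v w hv hw
  have hwvw := H.dirDeriv_curl_acc hc hq hv hw w
  rw [H.curl_acc hq] at hcvw
  have hb := H.curl_acc hq (u q) w
  have hUX : flat u (u q) q = 1 := H.unit q hq
  have hAX : flat (acc u) (u q) q = 0 := H.g_acc_vel hq
  have hvX : dirDeriv v (flat u (u q)) q = 0 := by rw [dirDeriv_flat hd, H.g_fderiv_vel hq]
  have hwX : dirDeriv w (flat u (u q)) q = 0 := by rw [dirDeriv_flat hd, H.g_fderiv_vel hq]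
  have hXv : dirDeriv (u q) (flat u v) q = flat (acc u) v q := dirDeriv_flat hd _ _
  have hXw : dirDeriv (u q) (flat u w) q = flat (acc u) w q := dirDeriv_flat hd _ _
  generalize curl (acc u) q (u q) w = b at *
  generalize curl (acc u) q (u q) v = b' at *
  -- From here `X` is a constant vector, so it can serve as a fixed direction; what is needed of its
  -- relation to `u` at `q` has been recorded above.
  generalize u q = X at *
  have s_vw := H.dirDeriv_flat_add v w hq
  have s_vv := H.dirDeriv_flat_add v v hq
  have s_ww := H.dirDeriv_flat_add w w hq
  have t_Xww := H.dirDeriv_strain X w w hq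
  have t_Xvw := H.dirDeriv_strain X v w hq
  have t_wXw := H.dirDeriv_strain w X w hq
  have t_vXw := H.dirDeriv_strain v X w hq
  have t_wvX := H.dirDeriv_strain w v X hq
  have r_ww := H.dirDeriv_dirDeriv_strain X v w w hq
  have r_vw := H.dirDeriv_dirDeriv_strain X w v w hq
  have r_Xw := H.dirDeriv_dirDeriv_strain w v X w hq
  have r_vX := H.dirDeriv_dirDeriv_strain w w v X hq
  have c_Xww := dirDeriv_comm ho (hU w) X w hq
  have c_Xvw := dirDeriv_comm ho (hU w) X v hq
  have c_Xwv := dirDeriv_comm ho (hU v) X w hq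
  have c_vwX := dirDeriv_comm ho (hU X) v w hq
  have k1 := dirDeriv_comm₂ ho (hU w) X v w hq
  have k2 := dirDeriv_comm₂ ho (hU w) w v X hq
  have k3 := dirDeriv_comm ho ((hU w).dirDeriv ho v) X w hq
  have k4 := dirDeriv_comm ho ((hU v).dirDeriv ho w) X w hq
  have k5 := dirDeriv_comm₂ ho (hU X) w v w hq
  have k6 := dirDeriv_comm₂ ho (hU v) w w X hq
  have k7 := dirDeriv_comm₂ ho (hU w) w X v hq
  simp only [hv, hw, hUX, hAX, hvX, hwX, hXv, hXw, zero_mul, mul_zero, one_mul, mul_one, add_zero,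
    zero_add] at *
  have e_vv : dirDeriv v (flat u v) q = 0 := by linarith
  have e_ww : dirDeriv w (flat u w) q = 0 := by linarith
  have e_wv : dirDeriv w (flat u v) q = - dirDeriv v (flat u w) q := by linarith
  simp only [e_vv, e_ww, e_wv, zero_mul, mul_zero, add_zero] at *
  have f1 : dirDeriv X (dirDeriv w (flat u w)) q = flat (acc u) w q * flat (acc u) w q := by
    linarith
  have f2 : dirDeriv X (dirDeriv v (flat u w)) q = flat (acc u) v q * flat (acc u) w q := by
    linarith
  have f3 : dirDeriv X (dirDeriv w (flat u v)) q = flat (acc u) v q * flat (acc u) w q := by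
    linarith
  have f4 : dirDeriv w (dirDeriv w (flat u X)) q
      = dirDeriv w (flat (acc u) w) q - flat (acc u) w q * flat (acc u) w q := by
    linarith
  have f5 : dirDeriv w (dirDeriv v (flat u X)) q
      = dirDeriv w (flat (acc u) v) q - flat (acc u) v q * flat (acc u) w q := by
    linarith
  have f6 : dirDeriv v (flat (acc u) w) q = dirDeriv w (flat (acc u) v) q := by linarith
  simp only [f1, f2, f3, f4, f5, f6] at r_ww r_vw r_Xw r_vX
  subst hb
  linarith

end IsUnitRigid
end Minkowski

/-- A vector space is not the union of two proper subspaces, here the kernels. -/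
theorem LinearMap.eq_zero_or_eq_zero_of_forall {V W W' : Type*} [AddCommGroup V] [Module ℝ V]
    [AddCommGroup W] [Module ℝ W] [AddCommGroup W'] [Module ℝ W'] (f : V →ₗ[ℝ] W) (g : V →ₗ[ℝ] W')
    (h : ∀ v, f v = 0 ∨ g v = 0) : f = 0 ∨ g = 0 := by
  by_contra! hne
  obtain ⟨x, hx⟩ := DFunLike.ne_iff.1 hne.1
  obtain ⟨y, hy⟩ := DFunLike.ne_iff.1 hne.2
  have hgx : g x = 0 := (h x).resolve_left hx
  have hfy : f y = 0 := (h y).resolve_right hy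
  rcases h (x + y) with h | h
  · exact hx (by simpa [hfy] using h)
  · exact hy (by simpa [hgx] using h)

theorem LinearMap.BilinForm.eq_zero_or_eq_zero_of_forall_mul {V : Type*} [AddCommGroup V]
    [Module ℝ V] (B C : LinearMap.BilinForm ℝ V) (h : ∀ v w, B v w * C v w = 0) :
    B = 0 ∨ C = 0 :=
  LinearMap.eq_zero_or_eq_zero_of_forall B C fun v =>
    LinearMap.eq_zero_or_eq_zero_of_forall (B v) (C v) fun w => mul_eq_zero.1 (h v w)

/-! ### Functions with values on a ray. -/

section Ray

variable {E F : Type*} [NormedAddCommGroup E] [NormedSpace ℝ E]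
  [NormedAddCommGroup F] [NormedSpace ℝ F]

/-- A function whose derivative is everywhere a multiple of itself stays locally on a ray. -/
theorem eventually_eq_pos_smul_of_fderiv {S : Set E} (hS : IsOpen S) {σ : E → F} {α : E → E → ℝ}
    (hσ : ∀ q ∈ S, DifferentiableAt ℝ σ q) (h : ∀ q ∈ S, ∀ v, fderiv ℝ σ q v = α q v • σ q)
    {p : E} (hp : p ∈ S) (h0 : σ p ≠ 0) :
    ∀ᶠ q in nhds p, ∃ r : ℝ, 0 < r ∧ σ q = r • σ p := by
  obtain ⟨l, -, hl⟩ := exists_dual_vector ℝ (σ p) (norm_ne_zero_iff.2 h0)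
  have hlp : 0 < l (σ p) := by rw [hl]; simpa using h0
  have hcont : ContinuousAt (fun q => l (σ q)) p :=
    l.continuous.continuousAt.comp (hσ p hp).continuousAt
  obtain ⟨ε, hε, hball⟩ := Metric.eventually_nhds_iff_ball.1
    ((hcont.eventually (lt_mem_nhds hlp)).and (hS.mem_nhds hp))
  filter_upwards [Metric.ball_mem_nhds p hε] with q hq
  -- Normalizing by a functional `l` that is positive on `σ` near `p` removes the radial part of the
  -- derivative, which is all there is.
  have hderiv : ∀ x ∈ Metric.ball p ε,
      HasFDerivAt (fun q => (l (σ q))⁻¹ • σ q) (0 : E →L[ℝ] F) x := by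
    intro x hx
    obtain ⟨hpos, hxS⟩ := hball x hx
    have h1 := (hσ x hxS).hasFDerivAt
    have h2 : HasFDerivAt (fun q => l (σ q)) (l.comp (fderiv ℝ σ x)) x := l.hasFDerivAt.comp x h1
    have h3 := ((hasDerivAt_inv hpos.ne').comp_hasFDerivAt x h2).smul h1
    refine h3.congr_fderiv ?_
    ext v
    simp only [Function.comp_apply, add_apply, smul_apply, ContinuousLinearMap.smulRight_apply,
      ContinuousLinearMap.comp_apply, h x hxS, map_smul, smul_eq_mul, zero_apply, smul_smul,
      ← add_smul]
    convert zero_smul ℝ (σ x)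
    field_simp
    ring
  have hconst := Metric.isOpen_ball.is_const_of_fderiv_eq_zero (convex_ball p ε).isPreconnected
    (fun x hx => (hderiv x hx).differentiableAt.differentiableWithinAt)
    (fun x hx => (hderiv x hx).fderiv) hq (Metric.mem_ball_self hε)
  have hq0 := (hball q hq).1
  refine ⟨l (σ q) * (l (σ p))⁻¹, by positivity, ?_⟩
  rw [mul_smul, ← hconst, smul_smul, mul_inv_cancel₀ hq0.ne', one_smul]

/-- A functional that is positive at `x` recovers the coefficient `r` continuously. The endpoint `0`
is included because the open ray is not closed. -/
theorem isClosed_nonneg_ray (x : F) (hx : x ≠ 0) : IsClosed {y : F | ∃ r : ℝ, 0 ≤ r ∧ y = r • x} := by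
  obtain ⟨l, -, hl⟩ := exists_dual_vector ℝ x (norm_ne_zero_iff.2 hx)
  have hlx : 0 < l x := by rw [hl]; simpa using hx
  have : {y : F | ∃ r : ℝ, 0 ≤ r ∧ y = r • x} =
      {y | 0 ≤ l y * (l x)⁻¹} ∩ {y | y = (l y * (l x)⁻¹) • x} := by
    ext y
    constructor
    · rintro ⟨r, hr, rfl⟩
      have : l (r • x) * (l x)⁻¹ = r := by
        rw [map_smul, smul_eq_mul, mul_inv_cancel_right₀ hlx.ne']
      exact ⟨by rwa [Set.mem_ofPred, this], by rw [Set.mem_ofPred, this]⟩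
    · rintro ⟨h1, h2⟩
      exact ⟨_, h1, h2⟩
  rw [this]
  exact (isClosed_le continuous_const (by fun_prop)).inter (isClosed_eq continuous_id (by fun_prop))

end Ray

/-! ### Killing data: closedness of the acceleration form, transport and propagation. -/

namespace Minkowski

variable {d : ℕ} {Ω : Set (Minkowski d)} {u : Minkowski d → Minkowski d}

/-- For a unit rigid field, the vorticity does not vanish at `q`. -/
def IsRotationalAt (u : Minkowski d → Minkowski d) (q : Minkowski d) : Prop :=
  ∃ v w, flat u v q = 0 ∧ flat u w q = 0 ∧ g d (fderiv ℝ u q v) w ≠ 0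

/-- If `u = K / √(g (K, K))` with `K` a Killing field, then this is the derivative of `K` divided
by `√(g (K, K))`. -/
noncomputable def killingDeriv (u : Minkowski d → Minkowski d) (q : Minkowski d) :
    Minkowski d →L[ℝ] Minkowski d :=
  fderiv ℝ u q - (gL d (acc u q)).smulRight (u q)

/-- The linear and the constant part of the Killing field that has at `q` the value `u q` and the
derivative `killingDeriv u q`. -/
noncomputable def killingData (u : Minkowski d → Minkowski d) (q : Minkowski d) :
    (Minkowski d →L[ℝ] Minkowski d) × Minkowski d :=
  (killingDeriv u q, u q - killingDeriv u q q)

theorem g_killingDeriv (q v w : Minkowski d) : g d (killingDeriv u q v) w =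
    g d (fderiv ℝ u q v) w - g d (acc u q) v * g d (u q) w := by
  simp [killingDeriv, gL_apply]

theorem proj_one_apply (q v : Minkowski d) : proj 1 u q v = v - g d (u q) v • u q := by
  simp [proj]

namespace IsUnitRigid

variable (H : IsUnitRigid Ω u)

include H

/-- Test vectors at `q` are projected onto the complement of `u` at nearby points, where the
vorticity on them stays nonzero by continuity. -/
theorem isOpen_isRotationalAt : IsOpen {q ∈ Ω | IsRotationalAt u q} := by
  rw [isOpen_iff_mem_nhds]
  rintro q ⟨hq, v, w, hv, hw, hne⟩
  have hP : ∀ v, ContDiffOn ℝ ∞ (fun q => v - flat u v q • u q) Ω := fun v =>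
    contDiffOn_const.sub ((H.contDiffOn_flat_vel v).smul H.smooth)
  have hF : ContDiffOn ℝ ∞ (fun q => gL d (fderiv ℝ u q (v - flat u v q • u q))
      (w - flat u w q • u q)) Ω :=
    ContDiffOn.clm_apply ((gL d).contDiff.comp_contDiffOn
      ((H.smooth.fderiv_of_isOpen H.isOpen (by simp)).clm_apply (hP v))) (hP w)
  have hc := (hF.differentiableAt_of_isOpen H.isOpen hq).continuousAt
  have hne' : gL d (fderiv ℝ u q (v - flat u v q • u q)) (w - flat u w q • u q) ≠ 0 := by
    simpa [hv, hw, gL_apply] using hne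
  filter_upwards [hc.eventually_ne hne', H.isOpen.mem_nhds hq] with p hp hpΩ
  exact ⟨hpΩ, _, _, H.g_vel_sub hpΩ v, H.g_vel_sub hpΩ w, hp⟩

theorem curl_acc_eq_zero_of_orthogonal {q : Minkowski d} (hq : q ∈ Ω) (hr : IsRotationalAt u q)
    (v w : Minkowski d) (hv : flat u v q = 0) (hw : flat u w q = 0) :
    curl (acc u) q v w = 0 := by
  obtain ⟨v₀, w₀, hv₀, hw₀, hne⟩ := hr
  have hP : ∀ v, flat u v q = 0 → proj 1 u q v = v := fun v hv => by
    rw [proj_one_apply, show g d (u q) v = 0 from hv, zero_smul, sub_zero]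
  have hP' : ∀ v, flat u (proj 1 u q v) q = 0 := fun v => by
    rw [proj_one_apply]; exact H.g_vel_sub hq v
  rcases LinearMap.BilinForm.eq_zero_or_eq_zero_of_forall_mul
    ((nablaFlat u q).comp (proj 1 u q) (proj 1 u q))
    ((nablaFlat (acc u) q - (nablaFlat (acc u) q).flip).comp (proj 1 u q) (proj 1 u q))
    (fun v w => by
      have h := H.vorticity_mul_curl_acc hq (hP' v) (hP' w)
      rw [← H.curl_acc hq, dirDeriv_flat (H.differentiableAt hq)] at h
      exact h) with h | h
  · have h1 := LinearMap.congr_fun₂ h v₀ w₀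
    rw [LinearMap.BilinForm.comp_apply, hP _ hv₀, hP _ hw₀] at h1
    exact absurd h1 hne
  · have h1 := LinearMap.congr_fun₂ h v w
    rw [LinearMap.BilinForm.comp_apply, hP _ hv, hP _ hw] at h1
    exact h1

/-- The second compatibility condition differentiates the vanishing of `da♭` on the complement of
`u`, so it is applied on the open set of rotational points. -/
theorem curl_acc_eq_zero {q : Minkowski d} (hq : q ∈ Ω) (hr : IsRotationalAt u q)
    (v w : Minkowski d) : curl (acc u) q v w = 0 := by
  have HS := H.mono H.isOpen_isRotationalAt fun q hq => hq.1
  have hc : ∀ q ∈ {q ∈ Ω | IsRotationalAt u q}, ∀ v w, flat u v q = 0 → flat u w q = 0 →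
      curl (acc u) q v w = 0 := fun q hq => H.curl_acc_eq_zero_of_orthogonal hq.1 hq.2
  have hb : ∀ w, flat u w q = 0 → curl (acc u) q (u q) w = 0 := by
    obtain ⟨v₀, w₀, hv₀, hw₀, hne⟩ := hr
    intro w hw
    have hP : ∀ v, flat u v q = 0 → proj 1 u q v = v := fun v hv => by
      rw [proj_one_apply, show g d (u q) v = 0 from hv, zero_smul, sub_zero]
    have hP' : ∀ v, flat u (proj 1 u q v) q = 0 := fun v => by
      rw [proj_one_apply]; exact H.g_vel_sub hq v
    -- Fixing `v₀` with `ω(v₀, ·) ≠ 0` leaves a product of two linear forms in `w`.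
    rcases LinearMap.eq_zero_or_eq_zero_of_forall
      ((nablaFlat u q v₀) ∘ₗ (proj 1 u q))
      (((nablaFlat (acc u) q - (nablaFlat (acc u) q).flip) (u q)) ∘ₗ (proj 1 u q))
      (fun w => by
        have h := HS.vorticity_mul_curl_acc_vel hc ⟨hq, v₀, w₀, hv₀, hw₀, hne⟩ hv₀ (hP' w)
        rw [dirDeriv_flat (H.differentiableAt hq)] at h
        exact mul_eq_zero.1 h) with h | h
    · have h1 := LinearMap.congr_fun h w₀
      rw [LinearMap.comp_apply, hP _ hw₀] at h1
      exact absurd h1 hne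
    · have h1 := LinearMap.congr_fun h w
      rw [LinearMap.comp_apply, hP _ hw] at h1
      exact h1
  have hb' : ∀ w, curl (acc u) q (u q) w = 0 := fun w => by
    have h := hb _ (H.g_vel_sub hq w)
    rwa [sub_eq_add_neg, ← neg_smul, curl_add_smul_right, curl_self, mul_zero, add_zero] at h
  rw [H.curl_acc_eq hq (H.curl_acc_eq_zero_of_orthogonal hq hr), hb', hb', mul_zero, mul_zero,
    sub_zero]

theorem g_killingDeriv_antisymm {q : Minkowski d} (hq : q ∈ Ω) (v w : Minkowski d) :
    g d (killingDeriv u q v) w + g d v (killingDeriv u q w) = 0 := by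
  rw [g_comm v, g_killingDeriv, g_killingDeriv]
  linarith [H.strain q hq v w]

theorem contDiffOn_killingDeriv : ContDiffOn ℝ ∞ (killingDeriv u) Ω :=
  (H.smooth.fderiv_of_isOpen H.isOpen (by simp)).sub
    (((gL d).contDiff.comp_contDiffOn (contDiffOn_acc H.isOpen H.smooth)).smulRight H.smooth)

theorem contDiffOn_killingData : ContDiffOn ℝ ∞ (killingData u) Ω :=
  H.contDiffOn_killingDeriv.prodMk
    (H.smooth.sub (H.contDiffOn_killingDeriv.clm_apply contDiffOn_id))

/-- As in Koszul's formula, three cyclic first derivatives of the symmetrized derivative determine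
all second derivatives of `u♭`; `da♭ = 0` then brings the result into this form. -/
theorem dirDeriv_dirDeriv_flat_vel {q : Minkowski d} (hq : q ∈ Ω)
    (hc : ∀ v w, curl (acc u) q v w = 0) (x v w : Minkowski d) :
    dirDeriv x (dirDeriv v (flat u w)) q =
      dirDeriv x (flat (acc u) v) q * flat u w q + flat (acc u) v q * dirDeriv x (flat u w) q
      + flat (acc u) x q * (dirDeriv v (flat u w) q - flat (acc u) v q * flat u w q) := by
  have hU := H.contDiffOn_flat_vel
  have c_w := dirDeriv_comm H.isOpen (hU w) x v hq
  have c_v := dirDeriv_comm H.isOpen (hU v) x w hq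
  have c_x := dirDeriv_comm H.isOpen (hU x) v w hq
  have t1 := H.dirDeriv_strain x v w hq
  have t2 := H.dirDeriv_strain v x w hq
  have t3 := H.dirDeriv_strain w v x hq
  have s1 := H.dirDeriv_flat_add v w hq
  have s2 := H.dirDeriv_flat_add x w hq
  have s3 := H.dirDeriv_flat_add x v hq
  have d1 := hc x v
  have d2 := hc x w
  have d3 := hc v w
  rw [H.curl_acc hq] at d1 d2 d3
  beta_reduce at t1 t2 t3 s1 s2 s3
  linear_combination (1/2) * (t1 + t2 - t3 + c_w - c_v - c_x + flat (acc u) w q * s3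
    - flat (acc u) v q * s2 - flat (acc u) x q * s1 - flat u w q * d1 + flat u v q * d2
    + flat u x q * d3)

theorem fderiv_killingDeriv {q : Minkowski d} (hq : q ∈ Ω)
    (hc : ∀ v w, curl (acc u) q v w = 0) (x : Minkowski d) :
    fderiv ℝ (killingDeriv u) q x = g d (acc u q) x • killingDeriv u q := by
  have ho := H.isOpen
  have hd := H.contDiffOn_killingDeriv.differentiableAt_of_isOpen ho hq
  refine ContinuousLinearMap.ext fun v => eq_of_g fun w => ?_
  have hdv : HasFDerivAt (fun p => killingDeriv u p v) ((fderiv ℝ (killingDeriv u) q).flip v) q := by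
    simpa using hd.hasFDerivAt.clm_apply (hasFDerivAt_const v q)
  have h1 := dirDeriv_flat hdv.differentiableAt x w
  rw [hdv.fderiv, ContinuousLinearMap.flip_apply] at h1
  rw [← h1]
  have hU := H.contDiffOn_flat_vel
  have hA := H.contDiffOn_flat_acc
  have hK : ContDiffOn ℝ ∞ (flat (fun p => killingDeriv u p v) w) Ω :=
    contDiffOn_flat (H.contDiffOn_killingDeriv.clm_apply contDiffOn_const) w
  have he : Set.EqOn (dirDeriv v (flat u w))
      (fun p => flat (fun p => killingDeriv u p v) w p + flat (acc u) v p * flat u w p) Ω := by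
    intro p hp
    rw [dirDeriv_flat (H.differentiableAt hp)]
    simp only [flat, g_killingDeriv]
    ring
  have h2 := dirDeriv_congr ho he x hq
  rw [dirDeriv_add ho hK ((hA v).mul (hU w)) x hq, dirDeriv_mul ho (hA v) (hU w) x hq,
    H.dirDeriv_dirDeriv_flat_vel hq hc] at h2
  have h3 := he hq
  simp only [smul_apply, map_smul, LinearMap.smul_apply, smul_eq_mul]
  simp only [flat] at *
  rw [h3] at h2
  linarith

/-- For the constant part, the term `killingDeriv u q x` in the derivative of `u` cancels against
the derivative of the argument `q`. -/
theorem fderiv_killingData {q : Minkowski d} (hq : q ∈ Ω)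
    (hc : ∀ v w, curl (acc u) q v w = 0) (x : Minkowski d) :
    fderiv ℝ (killingData u) q x = g d (acc u q) x • killingData u q := by
  have hd := H.contDiffOn_killingDeriv.differentiableAt_of_isOpen H.isOpen hq
  have h1 := hd.hasFDerivAt.prodMk ((H.differentiableAt hq).hasFDerivAt.sub
    (hd.hasFDerivAt.clm_apply (hasFDerivAt_id q)))
  have h2 : fderiv ℝ (killingData u) q = _ := h1.fderiv
  have h3 : fderiv ℝ u q x = killingDeriv u q x + g d (acc u q) x • u q := by
    simp [killingDeriv, gL_apply]
  rw [h2]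
  ext1
  · simpa [killingData] using H.fderiv_killingDeriv hq hc x
  · simp only [ContinuousLinearMap.prod_apply, sub_apply, add_apply,
      ContinuousLinearMap.comp_apply, ContinuousLinearMap.flip_apply, h3,
      H.fderiv_killingDeriv hq hc x, killingData, Prod.smul_mk, smul_apply, id_eq,
      ContinuousLinearMap.id_apply, smul_sub]
    abel

theorem killingData_ne_zero {q : Minkowski d} (hq : q ∈ Ω) : killingData u q ≠ 0 := by
  intro h
  have h1 : killingDeriv u q = 0 := congrArg Prod.fst h
  have h2 : u q - killingDeriv u q q = 0 := congrArg Prod.snd h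
  rw [h1, zero_apply, sub_zero] at h2
  simpa [h2] using H.unit q hq

/-- Without vorticity only the part of `∂u` along `u` remains, and the Killing derivative is the
2-form `u♭ ∧ a♭`, of rank at most two. -/
theorem g_killingDeriv_of_not_isRotationalAt {q : Minkowski d} (hq : q ∈ Ω)
    (hr : ¬ IsRotationalAt u q) (v w : Minkowski d) : g d (killingDeriv u q v) w =
      g d (u q) v * g d (acc u q) w - g d (u q) w * g d (acc u q) v := by
  simp only [IsRotationalAt, not_exists, not_and, not_not] at hr
  have h := hr _ _ (H.g_vel_sub hq v) (H.g_vel_sub hq w)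
  have h1 := H.g_acc_vel hq
  have h2 := H.g_fderiv_vel hq v
  simp only [map_sub, map_smul, LinearMap.sub_apply, LinearMap.smul_apply, smul_eq_mul,
    show fderiv ℝ u q (u q) = acc u q from rfl, h1, h2] at h
  rw [g_killingDeriv]
  linarith

/-- A Killing motion that is rotational at one point is rotational everywhere. -/
theorem isRotationalAt_of_killingData_eq {p q : Minkowski d} (hp : p ∈ Ω) (hq : q ∈ Ω)
    (hr : IsRotationalAt u p) {r : ℝ} (h0 : r ≠ 0) (h : killingData u q = r • killingData u p) :
    IsRotationalAt u q := by
  by_contra hn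
  have hA := H.g_killingDeriv_of_not_isRotationalAt hq hn
  obtain ⟨v, w, hv, hw, hne⟩ := hr
  have h1 : killingDeriv u q = r • killingDeriv u p := congrArg Prod.fst h
  have h2 : u q - killingDeriv u q q = r • (u p - killingDeriv u p p) := congrArg Prod.snd h
  have h3 : r • u p = killingDeriv u q (p - q) + u q := by
    rw [map_sub, sub_add_eq_add_sub, add_sub_assoc, h2, h1, smul_apply, smul_sub]
    abel
  -- If `q` is not rotational, the Killing field with the data of `q` takes values in the span of `u
  -- q` and `acc u q` everywhere, in particular at `p`.
  have hu : ∀ y, r * g d (u p) y = g d (u q) (p - q) * g d (acc u q) y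
      + (1 - g d (acc u q) (p - q)) * g d (u q) y := fun y => by
    have := congrArg (fun z => g d z y) h3
    simp only [map_add, map_smul, LinearMap.add_apply, LinearMap.smul_apply, smul_eq_mul,
      hA (p - q) y] at this
    linarith
  have e1 := hu v
  have e2 := hu w
  have e3 := hu (u p)
  rw [show g d (u p) v = 0 from hv] at e1
  rw [show g d (u p) w = 0 from hw] at e2
  rw [H.unit p hp] at e3
  have e4 := hA v w
  rw [h1, smul_apply, map_smul, LinearMap.smul_apply, smul_eq_mul, g_killingDeriv,
    show g d (u p) w = 0 from hw, mul_zero, sub_zero] at e4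
  generalize g d (u q) (p - q) = α at *
  generalize 1 - g d (acc u q) (p - q) = β at *
  -- On vectors orthogonal to `u p`, the relation `α a♭ + β u♭ = 0` holds at `q`, so `α` and `β`
  -- both annihilate `u♭ ∧ a♭` there. That form is nonzero on `v`, `w`, which forces `u p = 0`.
  have hα : α * (r * g d (fderiv ℝ u p v) w) = 0 := by
    rw [e4]; linear_combination g d (u q) w * e1 - g d (u q) v * e2
  have hβ : β * (r * g d (fderiv ℝ u p v) w) = 0 := by
    rw [e4]; linear_combination g d (acc u q) v * e2 - g d (acc u q) w * e1
  have hne' := mul_ne_zero h0 hne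
  rw [(mul_eq_zero.1 hα).resolve_right hne', (mul_eq_zero.1 hβ).resolve_right hne'] at e3
  exact h0 (by linarith)

theorem exists_killingData_eq (hc : IsPreconnected Ω) {p : Minkowski d} (hp : p ∈ Ω)
    (hr : IsRotationalAt u p) {q : Minkowski d} (hq : q ∈ Ω) :
    ∃ r : ℝ, 0 < r ∧ killingData u q = r • killingData u p := by
  set Z := {q ∈ Ω | IsRotationalAt u q ∧ ∃ r : ℝ, 0 < r ∧ killingData u q = r • killingData u p}
    with hZ
  have hd : ∀ q ∈ Ω, DifferentiableAt ℝ (killingData u) q := fun q hq =>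
    H.contDiffOn_killingData.differentiableAt_of_isOpen H.isOpen hq
  have hZo : IsOpen Z := by
    rw [isOpen_iff_mem_nhds]
    rintro x ⟨hx, hxr, r, hr, hxd⟩
    have ho := H.isOpen_isRotationalAt
    have h := eventually_eq_pos_smul_of_fderiv ho (fun q hq => hd q hq.1)
      (fun q hq => H.fderiv_killingData hq.1 (H.curl_acc_eq_zero hq.1 hq.2)) ⟨hx, hxr⟩
      (H.killingData_ne_zero hx)
    filter_upwards [h, ho.mem_nhds ⟨hx, hxr⟩] with y ⟨s, hs, hy⟩ hyΩ
    exact ⟨hyΩ.1, hyΩ.2, s * r, by positivity, by rw [hy, hxd, smul_smul]⟩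
  have hsub : Ω ⊆ Z := by
    refine hc.subset_of_closure_inter_subset hZo
      ⟨p, hp, hp, hr, 1, one_pos, (one_smul ℝ _).symm⟩ ?_
    rintro x ⟨hxZ, hx⟩
    -- A limit of data on the positive ray lies on the closed ray, and not at its endpoint since the
    -- data never vanish.
    obtain ⟨r, hr0, hxr⟩ := (isClosed_nonneg_ray _
      (H.killingData_ne_zero hp)).mem_of_frequently_of_tendsto
      ((mem_closure_iff_frequently.1 hxZ).mono fun y hy =>
        ⟨hy.2.2.choose, hy.2.2.choose_spec.1.le, hy.2.2.choose_spec.2⟩) (hd x hx).continuousAt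
    have hne : r ≠ 0 := by
      rintro rfl
      exact H.killingData_ne_zero hx (by rw [hxr, zero_smul])
    exact ⟨hx, H.isRotationalAt_of_killingData_eq hp hx hr hne hxr, r, hr0.lt_of_ne' hne, hxr⟩
  exact (hsub hq).2.2

end IsUnitRigid
end Minkowski

/-! ### Reduction to units where `c = 1`. -/

namespace Minkowski

variable {d : ℕ} {Ω : Set (Minkowski d)} {u : Minkowski d → Minkowski d} {c : ℝ}

theorem fderiv_const_smul_vel {q : Minkowski d} (hd : DifferentiableAt ℝ u q) (r : ℝ)
    (v : Minkowski d) : fderiv ℝ (fun q => r • u q) q v = r • fderiv ℝ u q v := by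
  rw [fderiv_fun_const_smul hd, smul_apply]

/-- Rescaling a rigid velocity field to units where `c = 1`. -/
theorem IsRigid.isUnitRigid (hc : 0 < c) (hΩ : IsOpen Ω) (hu : IsVelocityField c Ω u)
    (hrigid : IsRigid c Ω u) : IsUnitRigid Ω (fun q => c⁻¹ • u q) where
  isOpen := hΩ
  smooth := hu.smooth.const_smul c⁻¹
  unit q hq := by
    simp only [map_smul, LinearMap.smul_apply, smul_eq_mul, hu.normalized q hq]
    field_simp
  strain q hq v w := by
    have hd := hu.smooth.differentiableAt_of_isOpen hΩ hq
    have horth : ∀ v, g d (u q) (fderiv ℝ u q v) = 0 := fun v => by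
      have h1 : (fun q => g d (u q) (u q)) =ᶠ[nhds q] fun _ => c ^ 2 :=
        Filter.eventuallyEq_of_mem (hΩ.mem_nhds hq) hu.normalized
      have h2 := fderiv_g hd hd v
      rw [h1.fderiv_eq, g_comm (fderiv ℝ u q v)] at h2
      simp only [fderiv_fun_const, Pi.zero_apply, zero_apply] at h2
      linarith
    have hflat : ∀ v, HasFDerivAt (fun q => g d (u q) v)
        (fderiv ℝ (fun q => g d (u q) v) q) q := fun v =>
      ((contDiffOn_flat hu.smooth v).differentiableAt_of_isOpen hΩ hq).hasFDerivAt
    have hflat' : ∀ v x, fderiv ℝ (fun q => g d (u q) v) q x = g d (fderiv ℝ u q x) v :=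
      fun v x => dirDeriv_flat hd x v
    have hT : fderiv ℝ (fun q => spatialMetric c u q v w) q (u q) =
        (c ^ 2)⁻¹ * (g d (u q) v * g d (fderiv ℝ u q (u q)) w
          + g d (fderiv ℝ u q (u q)) v * g d (u q) w) := by
      have h1 := (((hflat v).mul (hflat w)).const_mul (c ^ 2)⁻¹).sub_const (g d v w)
      have h2 : fderiv ℝ (fun q => spatialMetric c u q v w) q = _ := h1.fderiv
      rw [h2]
      simp only [smul_apply, add_apply, smul_eq_mul, hflat']
      ring
    have h := hrigid q hq v w
    rw [lieDeriv, hT] at h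
    -- Derivatives of `u` are orthogonal to `u`, so in the last two terms of the Lie derivative only
    -- the summand `-g` of `h` contributes.
    simp only [spatialMetric, LinearMap.sub_apply, LinearMap.smul_apply,
      LinearMap.BilinForm.linMulLin_apply, horth, smul_eq_mul, mul_zero, zero_mul, zero_sub] at h
    rw [g_comm v] at h
    simp only [acc, fderiv_const_smul_vel hd, map_smul, LinearMap.smul_apply, smul_eq_mul]
    have : (c ^ 2)⁻¹ = c⁻¹ * c⁻¹ := by rw [sq, mul_inv]
    rw [this] at h
    linear_combination (-c⁻¹) * h

theorem IsRotational.exists_isRotationalAt (hc : 0 < c) (hΩ : IsOpen Ω)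
    (hu : IsVelocityField c Ω u) (hrot : IsRotational c Ω u) :
    ∃ p ∈ Ω, IsRotationalAt (fun q => c⁻¹ • u q) p := by
  obtain ⟨p, hp, hne⟩ := hrot
  refine ⟨p, hp, ?_⟩
  by_contra hn
  simp only [IsRotationalAt, not_exists, not_and, not_not, flat,
    fderiv_const_smul_vel (hu.smooth.differentiableAt_of_isOpen hΩ hp), map_smul,
    LinearMap.smul_apply, smul_eq_mul, mul_eq_zero, inv_eq_zero, hc.ne', false_or] at hn
  have hP : ∀ v, g d (u p) (proj c u p v) = 0 := fun v => by
    have := hc.ne'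
    simp only [proj, LinearMap.sub_apply, LinearMap.id_apply, LinearMap.smul_apply,
      LinearMap.smulRight_apply, map_sub, map_smul, smul_eq_mul, hu.normalized p hp]
    field_simp
    ring
  refine hne (LinearMap.ext₂ fun v w => ?_)
  simp only [vorticity, nablaFlat, LinearMap.smul_apply, LinearMap.BilinForm.comp_apply,
    LinearMap.sub_apply, LinearMap.zero_apply, LinearMap.BilinForm.flip_apply,
    ContinuousLinearMap.coe_coe, LinearMap.id_apply, hn _ _ (hP v) (hP w), hn _ _ (hP w) (hP v),
    sub_self, smul_zero]

end Minkowski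

theorem mainTheorem1 {d : ℕ} {c : ℝ} (hc : 0 < c)
    {Ω : Set (Minkowski d)} (hΩ : IsOpen Ω) (hΩc : IsConnected Ω)
    {u : Minkowski d → Minkowski d}
    (hu : Minkowski.IsVelocityField c Ω u)
    (hrigid : Minkowski.IsRigid c Ω u)
    (hrot : Minkowski.IsRotational c Ω u) :
    Minkowski.IsKillingMotion c Ω u := by
  have H := hrigid.isUnitRigid hc hΩ hu
  obtain ⟨p, hp, hr⟩ := hrot.exists_isRotationalAt hc hΩ hu
  set A := Minkowski.killingDeriv (fun q => c⁻¹ • u q) p with hA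
  set b := (Minkowski.killingData (fun q => c⁻¹ • u q) p).2 with hb
  have hK : ∀ q, HasFDerivAt (fun q => A q + b) A q := fun q => A.hasFDerivAt.add_const b
  refine ⟨fun q => A q + b, ⟨(A.contDiff.add contDiff_const).contDiffOn, fun q _ v w => ?_⟩,
    fun q hq => ?_⟩
  · rw [Minkowski.lieDeriv, (hK q).fderiv, fderiv_fun_const]
    simpa using H.g_killingDeriv_antisymm hp v w
  -- Equality of data up to `r` means `c⁻¹ u = r K` at `q`; normalization of `u` and `r > 0` then
  -- give `r = 1 / √(g (K, K))`.
  · obtain ⟨r, hr0, hrq⟩ := H.exists_killingData_eq hΩc.isPreconnected hp hr hq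
    have h1 : Minkowski.killingDeriv (fun q => c⁻¹ • u q) q = r • A := congrArg Prod.fst hrq
    have h2 : c⁻¹ • u q - Minkowski.killingDeriv (fun q => c⁻¹ • u q) q q = r • b :=
      congrArg Prod.snd hrq
    have h3 : c⁻¹ • u q = r • (A q + b) := by
      rw [smul_add, ← h2, h1, smul_apply, add_sub_cancel]
    have h4 : r ^ 2 * Minkowski.g d (A q + b) (A q + b) = 1 := by
      have := H.unit q hq
      simp only [h3, map_smul, LinearMap.smul_apply, smul_eq_mul] at this
      linarith
    have h5 : Minkowski.g d (A q + b) (A q + b) = r⁻¹ ^ 2 := by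
      rw [inv_pow]; exact eq_inv_of_mul_eq_one_right h4
    refine ⟨by rw [h5]; positivity, ?_⟩
    rw [h5, Real.sqrt_sq (by positivity), div_inv_eq_mul, mul_smul, ← h3, smul_smul,
      mul_inv_cancel₀ hc.ne', one_smul]
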